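/- Conventions. A category $\mathbb E$ is \emph{regular} if it is finitely complete, regular epimorphisms are stable under pullback, and every kernel pair has a coequalizer; it is \emph{exact} if, moreover, every internal equivalence relation in $\mathbb E$ is effective, i.e. is the kernel pair of some morphism. A category is \emph{Mal'tsev} if it is finitely complete and every internal reflexive relation in it is an equivalence relation. Relations from $X$ to $Y$ are regarded as subobjects $\langle r_0,r_1\rangle\colon R\rightarrowtail X\times Y$. For relations $R\rightarrowtail X\times Y$ and $S\rightarrowtail Y\times Z$ in a regular category, $S\circ R\rightarrowtail X\times Z$ is the mono part of the (regular epi)-mono factorization of $\langle r_0\pi_0,s_1\pi_1\rangle\colon R\times_Y S\to X\times Z$, where $R\times_Y S$ is the pullback of $r_1$ and $s_0$, with projections $\pi_0,\pi_1$. For equivalence relations $R,S$ on $X$: $R\wedge S$ is their intersection as subobjects of $X\times X$; $\Delta_X$ is the diagonal of $X\times X$; $\nabla_X=X\times X$ is the largest equivalence relation on $X$; and $R\vee S=\nabla_X$ means that $\nabla_X$ is the supremum of $R$ and $S$ among the equivalence relations on $X$ (ordered by inclusion of subobjects). In an exact category, $q_R\colon X\to X/R$ denotes the coequalizer of $r_0,r_1\colon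 R\rightrightarrows X$. Theorem. Let $\mathbb E$ be an exact category. (1) Let $R$ and $S$ be equivalence relations on an object $X$ of $\mathbb E$ such that $R\wedge S=\Delta_X$, $R\circ S=S\circ R$ and $R\vee S=\nabla_X$. Then the canonical morphism $\langle q_R,q_S\rangle\colon X\to X/R\times X/S$ is an isomorphism; in particular $X\cong X/R\times X/S$. (2) Suppose that $\mathbb E$ is moreover a Mal'tsev category, and let $R$ and $S$ be equivalence relations on an object $X$ such that $R\wedge S=\Delta_X$ and $R\vee S=\nabla_X$. Then the canonical morphism $\langle q_R,q_S\rangle\colon X\to X/R\times X/S$ is an isomorphism. -/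

import Mathlib

open CategoryTheory CategoryTheory.Limits

universe v u

namespace DirectProduct

/-- A category is *exact* (in the sense of Barr) when it is regular and every internal equivalence
relation in it is effective, that is, the kernel pair of some morphism. -/
class BarrExact (C : Type u) [Category.{v} C] : Prop extends Regular C where
  effective : ∀ {R X : C} (r₀ r₁ : R ⟶ X), IsEquivalenceRelation r₀ r₁ →
    ∃ (Y : C) (f : X ⟶ Y), IsKernelPair f r₀ r₁

/-- A category is a *Mal'tsev category* when it is finitely complete and every internal reflexive
relation in it is an equivalence relation. -/
class Maltsev (C : Type u) [Category.{v} C] : Prop extends HasFiniteLimits C where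
  equivalence_of_reflexive : ∀ {R X : C} (r₀ r₁ : R ⟶ X),
    Nonempty (ReflexiveRelation r₀ r₁) → IsEquivalenceRelation r₀ r₁

section Relations

variable {C : Type u} [Category.{v} C] [HasFiniteLimits C]

/-- A relation from `X` to `Y` is a subobject of `X ⨯ Y`. -/
abbrev Relation (X Y : C) := Subobject (X ⨯ Y)

/-- The first projection `r₀` of a relation. -/
noncomputable abbrev Relation.p₀ {X Y : C} (R : Relation X Y) : (R : C) ⟶ X :=
  Subobject.arrow R ≫ prod.fst

/-- The second projection `r₁` of a relation. -/
noncomputable abbrev Relation.p₁ {X Y : C} (R : Relation X Y) : (R : C) ⟶ Y :=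
  Subobject.arrow R ≫ prod.snd

/-- The discrete relation `Δ_X`: the diagonal subobject of `X ⨯ X`. -/
noncomputable def discreteRel (X : C) : Relation X X := Subobject.mk (diag X)

/-- The equivalence relations on `X`, ordered by inclusion of subobjects of `X ⨯ X`. -/
abbrev EquivRel (X : C) := {R : Relation X X // IsEquivalenceRelation R.p₀ R.p₁}

theorem isKernelPair_top (X : C) :
    IsKernelPair (terminal.from X) (Relation.p₀ (⊤ : Relation X X))
      (Relation.p₁ (⊤ : Relation X X)) :=
  IsPullback.of_iso (IsPullback.of_is_product' (prodIsProd X X) terminalIsTerminal)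
    (asIso (Subobject.arrow (⊤ : Relation X X))).symm (Iso.refl X) (Iso.refl X) (Iso.refl _)
    (by simp [Relation.p₀]) (by simp [Relation.p₁])
    (Subsingleton.elim _ _) (Subsingleton.elim _ _)

/-- The indiscrete (largest) equivalence relation `∇_X`: all of `X ⨯ X`. -/
noncomputable def indiscrete (X : C) : EquivRel X :=
  ⟨⊤, (IsKernelPair.equivalenceRelation (terminal.from X) _ _
    (pullbackIsPullback _ _) (isKernelPair_top X)).isEquivalenceRelation⟩

end Relations

/-- The composite `S ∘ R` of a relation `R` from `X` to `Y` and a relation `S` from `Y` to `Z` in a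
regular category: the mono part of the (regular epi)-mono factorization of
`⟨r₀ π₀, s₁ π₁⟩ : R ×_Y S ⟶ X ⨯ Z`. -/
noncomputable def comp {C : Type u} [Category.{v} C] [Regular C] {X Y Z : C}
    (S : Relation Y Z) (R : Relation X Y) : Relation X Z :=
  Subobject.mk (Regular.strongEpiMonoFactorisation
    (prod.lift (pullback.fst R.p₁ S.p₀ ≫ R.p₀) (pullback.snd R.p₁ S.p₀ ≫ S.p₁))).m

section Quotients

variable {C : Type u} [Category.{v} C] [BarrExact C] {X : C}

theorem hasCoequalizer_of_equivRel (R : EquivRel X) : HasCoequalizer R.1.p₀ R.1.p₁ := by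
  obtain ⟨Y, f, h⟩ := BarrExact.effective _ _ R.2
  exact Regular.hasCoequalizer_of_isKernelPair h

attribute [local instance] hasCoequalizer_of_equivRel

/-- The quotient `X/R` of `X` by an equivalence relation `R`: the coequalizer of `r₀` and `r₁`. -/
noncomputable def quotient (R : EquivRel X) : C := coequalizer R.1.p₀ R.1.p₁

/-- The quotient map `q_R : X ⟶ X/R`. -/
noncomputable def quotientMap (R : EquivRel X) : X ⟶ quotient R := coequalizer.π R.1.p₀ R.1.p₁

end Quotients

end DirectProduct

/-!
A relation is determined by the pairs of generalized elements `a, b : T ⟶ X` that it relates, and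
in a regular category composites of relations are computed as in sets, the intermediate element
existing after passing to a cover (a strong epimorphism) of `T`. So the set-theoretic argument goes
through: two equivalence relations permute exactly when their composite is an equivalence relation,
which is then their join, and in the Mal'tsev case it always is one, because it is reflexive. For
quotients `f : X ⟶ Y` by `R` and `g : X ⟶ Z` by `S`, the condition `R ∧ S = Δ` makes `⟨f, g⟩` a
monomorphism, while `S ∘ R = ∇` makes it a strong epimorphism: cover `Y ⨯ Z` so that its
projections lift to `a` and `c` along `f` and `g`, and take `b` with `a R b S c`.
-/

namespace DirectProduct

attribute [local simp] prod.lift_fst prod.lift_snd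

section Relates

variable {C : Type u} [Category.{v} C] [HasFiniteLimits C] {T T' X Y : C}

namespace Relation

/-- The generalized elements `a : T ⟶ X` and `b : T ⟶ Y` are related by `R` when `⟨a, b⟩` factors
through the subobject `R` of `X ⨯ Y`. This is the form in which relations are reasoned about
elementwise. -/
def Relates (R : Relation X Y) (a : T ⟶ X) (b : T ⟶ Y) : Prop :=
  R.Factors (prod.lift a b)

variable {R S : Relation X Y} {a : T ⟶ X} {b : T ⟶ Y}

theorem relates_iff : R.Relates a b ↔ ∃ k : T ⟶ (R : C), k ≫ R.p₀ = a ∧ k ≫ R.p₁ = b := by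
  constructor
  · intro h
    rw [Relates] at h
    exact ⟨R.factorThru _ h, by simp, by simp⟩
  · rintro ⟨k, rfl, rfl⟩
    have fac : prod.lift (k ≫ R.p₀) (k ≫ R.p₁) = k ≫ R.arrow := by ext <;> simp
    rw [Relates, fac]
    exact Subobject.factors_comp_arrow k

theorem relates_projections (R : Relation X Y) : R.Relates R.p₀ R.p₁ :=
  relates_iff.2 ⟨𝟙 _, Category.id_comp _, Category.id_comp _⟩

theorem Relates.precomp (h : R.Relates a b) (e : T' ⟶ T) : R.Relates (e ≫ a) (e ≫ b) := by
  rw [Relates, ← prod.comp_lift]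
  exact Subobject.factors_of_factors_right e h

theorem Relates.of_strongEpi {e : T' ⟶ T} [StrongEpi e] (h : R.Relates (e ≫ a) (e ≫ b)) :
    R.Relates a b := by
  rw [Relates, ← prod.comp_lift] at h
  have sq : CommSq (R.factorThru _ h) e R.arrow (prod.lift a b) := ⟨R.factorThru_arrow _ h⟩
  exact (Subobject.factors_iff _ _).2 ⟨sq.lift, sq.fac_right⟩

theorem Relates.of_le (h : R.Relates a b) (hRS : R ≤ S) : S.Relates a b :=
  Subobject.factors_of_le _ hRS h

theorem le_of_relates
    (h : ∀ ⦃T : C⦄ (a : T ⟶ X) (b : T ⟶ Y), R.Relates a b → S.Relates a b) : R ≤ S := by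
  obtain ⟨k, hk₀, hk₁⟩ := relates_iff.1 (h _ _ (relates_projections R))
  refine Subobject.le_of_comm k ?_
  ext
  · simpa using hk₀
  · simpa using hk₁

theorem ext_relates
    (h : ∀ ⦃T : C⦄ (a : T ⟶ X) (b : T ⟶ Y), R.Relates a b ↔ S.Relates a b) : R = S :=
  le_antisymm (le_of_relates fun _ a b => (h a b).1) (le_of_relates fun _ a b => (h a b).2)

theorem inf_relates_iff : (R ⊓ S).Relates a b ↔ R.Relates a b ∧ S.Relates a b :=
  Subobject.inf_factors _

theorem top_relates (a : T ⟶ X) (b : T ⟶ Y) : (⊤ : Relation X Y).Relates a b :=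
  Subobject.top_factors _

theorem jointlyMono₂_projections (R : Relation X Y) : JointlyMono₂ R.p₀ R.p₁ where
  right_cancellation T f g h₀ h₁ := by
    rw [← cancel_mono R.arrow]
    ext
    · simpa using h₀
    · simpa using h₁

theorem nonempty_reflexiveRelation {R : Relation X X} (hrefl : R.Relates (𝟙 X) (𝟙 X)) :
    Nonempty (ReflexiveRelation R.p₀ R.p₁) := by
  obtain ⟨r, hr₀, hr₁⟩ := relates_iff.1 hrefl
  exact ⟨{ toJointlyMono₂ := jointlyMono₂_projections R
           r := r
           reflexivity₁ := hr₀
           reflexivity₂ := hr₁ }⟩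

theorem isEquivalenceRelation_of_relates {R : Relation X X} (hrefl : R.Relates (𝟙 X) (𝟙 X))
    (hsymm : ∀ ⦃T : C⦄ (a b : T ⟶ X), R.Relates a b → R.Relates b a)
    (htrans : ∀ ⦃T : C⦄ (a b c : T ⟶ X), R.Relates a b → R.Relates b c → R.Relates a c) :
    IsEquivalenceRelation R.p₀ R.p₁ := by
  have hfst := (relates_projections R).precomp (pullback.fst R.p₁ R.p₀)
  have hsnd := (relates_projections R).precomp (pullback.snd R.p₁ R.p₀)
  rw [← pullback.condition] at hsnd
  obtain ⟨reflexive⟩ := nonempty_reflexiveRelation hrefl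
  obtain ⟨s, hs₀, hs₁⟩ := relates_iff.1 (hsymm _ _ (relates_projections R))
  obtain ⟨t, ht₀, ht₁⟩ := relates_iff.1 (htrans _ _ _ hfst hsnd)
  exact ⟨⟨{ toReflexiveRelation := reflexive
            s := s
            symmetry₁ := hs₀
            symmetry₂ := hs₁
            c := pullback.cone R.p₁ R.p₀
            isLimit := pullback.isLimit R.p₁ R.p₀
            t := t
            transitivity₁ := ht₀
            transitivity₂ := ht₁ }⟩⟩

theorem relates_iff_of_isKernelPair {R : Relation X X} {f : X ⟶ Y}
    (hf : IsKernelPair f R.p₀ R.p₁) {a b : T ⟶ X} : R.Relates a b ↔ a ≫ f = b ≫ f := by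
  rw [relates_iff]
  constructor
  · rintro ⟨k, rfl, rfl⟩
    simpa only [Category.assoc] using congrArg (k ≫ ·) hf.w
  · intro w
    exact ⟨hf.lift a b w, hf.lift_fst a b w, hf.lift_snd a b w⟩

end Relation

theorem discreteRel_relates_iff {a b : T ⟶ X} : (discreteRel X).Relates a b ↔ a = b := by
  constructor
  · intro h
    obtain ⟨k, hk⟩ : ∃ k : T ⟶ X, k ≫ diag X = prod.lift a b :=
      (Subobject.mk_factors_iff (diag X) _).1 h
    have ha : k = a := by simpa using congrArg (· ≫ prod.fst) hk
    have hb : k = b := by simpa using congrArg (· ≫ prod.snd) hk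
    exact ha.symm.trans hb
  · rintro rfl
    exact (Subobject.mk_factors_iff (diag X) _).2 ⟨a, prod.comp_diag a⟩

namespace EquivRel

theorem refl (R : EquivRel X) (a : T ⟶ X) : R.1.Relates a a := by
  obtain ⟨⟨E⟩⟩ := R.2
  refine Relation.relates_iff.2 ⟨a ≫ E.r, ?_, ?_⟩
  · rw [Category.assoc, E.reflexivity₁, Category.comp_id]
  · rw [Category.assoc, E.reflexivity₂, Category.comp_id]

theorem symm (R : EquivRel X) {a b : T ⟶ X} (h : R.1.Relates a b) : R.1.Relates b a := by
  obtain ⟨⟨E⟩⟩ := R.2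
  obtain ⟨k, rfl, rfl⟩ := Relation.relates_iff.1 h
  refine Relation.relates_iff.2 ⟨k ≫ E.s, ?_, ?_⟩
  · rw [Category.assoc, E.symmetry₁]
  · rw [Category.assoc, E.symmetry₂]

theorem trans (R : EquivRel X) {a b c : T ⟶ X} (hab : R.1.Relates a b) (hbc : R.1.Relates b c) :
    R.1.Relates a c := by
  obtain ⟨⟨E⟩⟩ := R.2
  obtain ⟨k, rfl, rfl⟩ := Relation.relates_iff.1 hab
  obtain ⟨l, hl, rfl⟩ := Relation.relates_iff.1 hbc
  let m := PullbackCone.IsLimit.lift E.isLimit k l hl.symm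
  have hm₀ : m ≫ E.c.fst = k := PullbackCone.IsLimit.lift_fst ..
  have hm₁ : m ≫ E.c.snd = l := PullbackCone.IsLimit.lift_snd ..
  refine Relation.relates_iff.2 ⟨m ≫ E.t, ?_, ?_⟩
  · rw [Category.assoc, E.transitivity₁, reassoc_of% hm₀]
  · rw [Category.assoc, E.transitivity₂, reassoc_of% hm₁]

end EquivRel

theorem mono_prodLift_of_inf_le_discreteRel {Z : C} {R S : Relation X X} {f : X ⟶ Y} {g : X ⟶ Z}
    (hf : IsKernelPair f R.p₀ R.p₁) (hg : IsKernelPair g S.p₀ S.p₁)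
    (hinf : R ⊓ S ≤ discreteRel X) : Mono (prod.lift f g) where
  right_cancellation a b w := by
    have hR : R.Relates a b := (Relation.relates_iff_of_isKernelPair hf).2 <| by
      simpa using congrArg (· ≫ prod.fst) w
    have hS : S.Relates a b := (Relation.relates_iff_of_isKernelPair hg).2 <| by
      simpa using congrArg (· ≫ prod.snd) w
    exact discreteRel_relates_iff.1 ((Relation.inf_relates_iff.2 ⟨hR, hS⟩).of_le hinf)

end Relates

section Composition

variable {C : Type u} [Category.{v} C] [Regular C] {T X Y Z : C}

theorem exists_strongEpi_lift_of_isRegularEpi (f : X ⟶ Y) [IsRegularEpi f] (y : T ⟶ Y) :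
    ∃ (T' : C) (e : T' ⟶ T) (x : T' ⟶ X), StrongEpi e ∧ x ≫ f = e ≫ y :=
  ⟨_, pullback.snd f y, pullback.fst f y, inferInstance, pullback.condition⟩

theorem comp_relates {R : Relation X Y} {S : Relation Y Z} {a : T ⟶ X} {b : T ⟶ Y} {c : T ⟶ Z}
    (hR : R.Relates a b) (hS : S.Relates b c) : (comp S R).Relates a c := by
  obtain ⟨k, rfl, hk⟩ := Relation.relates_iff.1 hR
  obtain ⟨l, hl, rfl⟩ := Relation.relates_iff.1 hS
  let F := Regular.strongEpiMonoFactorisation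
    (prod.lift (pullback.fst R.p₁ S.p₀ ≫ R.p₀) (pullback.snd R.p₁ S.p₀ ≫ S.p₁))
  refine (Subobject.mk_factors_iff F.m _).2 ⟨pullback.lift k l (hk.trans hl.symm) ≫ F.e, ?_⟩
  change (_ ≫ F.e) ≫ F.m = _
  rw [Category.assoc, F.fac, prod.comp_lift, pullback.lift_fst_assoc, pullback.lift_snd_assoc]

theorem comp_relates_iff {R : Relation X Y} {S : Relation Y Z} {a : T ⟶ X} {c : T ⟶ Z} :
    (comp S R).Relates a c ↔ ∃ (T' : C) (e : T' ⟶ T) (b : T' ⟶ Y),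
      StrongEpi e ∧ R.Relates (e ≫ a) b ∧ S.Relates b (e ≫ c) := by
  constructor
  · intro h
    let F := Regular.strongEpiMonoFactorisation
      (prod.lift (pullback.fst R.p₁ S.p₀ ≫ R.p₀) (pullback.snd R.p₁ S.p₀ ≫ S.p₁))
    obtain ⟨y, hy⟩ : ∃ y : T ⟶ F.I, y ≫ F.m = prod.lift a c :=
      (Subobject.mk_factors_iff F.m _).1 h
    obtain ⟨T', e, x, he, hx⟩ := exists_strongEpi_lift_of_isRegularEpi F.e y
    have hxac : x ≫ prod.lift (pullback.fst R.p₁ S.p₀ ≫ R.p₀) (pullback.snd R.p₁ S.p₀ ≫ S.p₁) =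
        e ≫ prod.lift a c := by
      rw [← hy, ← reassoc_of% hx, F.fac]
    have ha : x ≫ pullback.fst R.p₁ S.p₀ ≫ R.p₀ = e ≫ a := by
      simpa only [Category.assoc, prod.lift_fst] using congrArg (· ≫ prod.fst) hxac
    have hc : x ≫ pullback.snd R.p₁ S.p₀ ≫ S.p₁ = e ≫ c := by
      simpa only [Category.assoc, prod.lift_snd] using congrArg (· ≫ prod.snd) hxac
    refine ⟨T', e, x ≫ pullback.fst R.p₁ S.p₀ ≫ R.p₁, he, ?_, ?_⟩
    · rw [← ha]
      exact ((Relation.relates_projections R).precomp _).precomp _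
    · rw [← hc, pullback.condition]
      exact ((Relation.relates_projections S).precomp _).precomp _
  · rintro ⟨T', e, b, _, hR, hS⟩
    exact (comp_relates hR hS).of_strongEpi

theorem comp_relates_refl (R S : EquivRel X) (a : T ⟶ X) : (comp S.1 R.1).Relates a a :=
  comp_relates (R.refl a) (S.refl a)

theorem comp_relates_swap {R S : EquivRel X} {a c : T ⟶ X} (h : (comp S.1 R.1).Relates a c) :
    (comp R.1 S.1).Relates c a := by
  obtain ⟨T', e, b, _, hR, hS⟩ := comp_relates_iff.1 h
  exact (comp_relates (S.symm hS) (R.symm hR)).of_strongEpi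

theorem comp_relates_trans_of_comp_comm {R S : EquivRel X}
    (hcomm : comp R.1 S.1 = comp S.1 R.1) {a b c : T ⟶ X} (hab : (comp S.1 R.1).Relates a b)
    (hbc : (comp S.1 R.1).Relates b c) : (comp S.1 R.1).Relates a c := by
  obtain ⟨T₁, e₁, x, _, hax, hxb⟩ := comp_relates_iff.1 hab
  refine Relation.Relates.of_strongEpi (e := e₁) ?_
  obtain ⟨T₂, e₂, y, _, hby, hyc⟩ := comp_relates_iff.1 (hbc.precomp e₁)
  refine Relation.Relates.of_strongEpi (e := e₂) ?_
  have hxy : (comp S.1 R.1).Relates (e₂ ≫ x) y := hcomm ▸ comp_relates (hxb.precomp e₂) hby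
  obtain ⟨T₃, e₃, z, _, hxz, hzy⟩ := comp_relates_iff.1 hxy
  refine Relation.Relates.of_strongEpi (e := e₃) ?_
  exact comp_relates (R.trans ((hax.precomp e₂).precomp e₃) hxz) (S.trans hzy (hyc.precomp e₃))

theorem isEquivalenceRelation_comp_iff {R S : EquivRel X} :
    IsEquivalenceRelation (comp S.1 R.1).p₀ (comp S.1 R.1).p₁ ↔
      comp R.1 S.1 = comp S.1 R.1 := by
  constructor
  · intro h
    let E : EquivRel X := ⟨comp S.1 R.1, h⟩
    exact Relation.ext_relates fun T a c =>
      ⟨fun hac => E.symm (comp_relates_swap hac), fun hac => comp_relates_swap (E.symm hac)⟩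
  · intro hcomm
    refine Relation.isEquivalenceRelation_of_relates (comp_relates_refl R S (𝟙 X)) ?_ ?_
    · intro T a b hab
      exact hcomm ▸ comp_relates_swap hab
    · intro T a b c
      exact comp_relates_trans_of_comp_comm hcomm

theorem isLUB_comp {R S : EquivRel X}
    (h : IsEquivalenceRelation (comp S.1 R.1).p₀ (comp S.1 R.1).p₁) :
    IsLUB {R, S} (⟨comp S.1 R.1, h⟩ : EquivRel X) := by
  constructor
  · rintro Q (rfl | rfl)
    · exact Relation.le_of_relates fun T a b hab => comp_relates hab (S.refl b)
    · exact Relation.le_of_relates fun T a b hab => comp_relates (R.refl a) hab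
  · intro Q hQ
    have hRQ : R.1 ≤ Q.1 := hQ (Set.mem_insert R {S})
    have hSQ : S.1 ≤ Q.1 := hQ (Set.mem_insert_of_mem R rfl)
    refine Relation.le_of_relates fun T a c hac => ?_
    obtain ⟨T', e, b, _, hab, hbc⟩ := comp_relates_iff.1 hac
    exact (Q.trans (hab.of_le hRQ) (hbc.of_le hSQ)).of_strongEpi

theorem Maltsev.comp_comm [Maltsev C] (R S : EquivRel X) : comp R.1 S.1 = comp S.1 R.1 :=
  isEquivalenceRelation_comp_iff.1 <| Maltsev.equivalence_of_reflexive _ _ <|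
    Relation.nonempty_reflexiveRelation (comp_relates_refl R S (𝟙 X))

theorem strongEpi_prodLift_of_comp_eq_top {R S : Relation X X} {f : X ⟶ Y} {g : X ⟶ Z}
    [IsRegularEpi f] [IsRegularEpi g] (hf : IsKernelPair f R.p₀ R.p₁)
    (hg : IsKernelPair g S.p₀ S.p₁) (htop : comp S R = ⊤) : StrongEpi (prod.lift f g) := by
  obtain ⟨T₁, e₁, a, _, ha⟩ := exists_strongEpi_lift_of_isRegularEpi f (prod.fst : Y ⨯ Z ⟶ Y)
  obtain ⟨T₂, e₂, c, _, hc⟩ := exists_strongEpi_lift_of_isRegularEpi g (e₁ ≫ prod.snd)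
  have hac : (comp S R).Relates (e₂ ≫ a) c := htop ▸ Relation.top_relates (e₂ ≫ a) c
  obtain ⟨T₃, e₃, b, _, hab, hbc⟩ := comp_relates_iff.1 hac
  rw [Relation.relates_iff_of_isKernelPair hf] at hab
  rw [Relation.relates_iff_of_isKernelPair hg] at hbc
  have hb : b ≫ prod.lift f g = e₃ ≫ e₂ ≫ e₁ := by
    ext
    · simp [← hab, ha]
    · simp [hbc, hc]
  have : StrongEpi (b ≫ prod.lift f g) := by
    rw [hb]
    infer_instance
  exact strongEpi_of_strongEpi b _

end Composition

section Quotients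

variable {C : Type u} [Category.{v} C] [BarrExact C] {X : C}

attribute [local instance] hasCoequalizer_of_equivRel

instance isRegularEpi_quotientMap (R : EquivRel X) : IsRegularEpi (quotientMap R) :=
  inferInstanceAs (IsRegularEpi (coequalizer.π R.1.p₀ R.1.p₁))

theorem isKernelPair_quotientMap (R : EquivRel X) :
    IsKernelPair (quotientMap R) R.1.p₀ R.1.p₁ := by
  obtain ⟨Y, f, hf⟩ := BarrExact.effective _ _ R.2
  have hdesc : quotientMap R ≫ coequalizer.desc f hf.w = f := coequalizer.π_desc _ _
  rw [← hdesc] at hf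
  exact hf.cancel_right (coequalizer.condition _ _)

end Quotients

end DirectProduct

open DirectProduct in
theorem mainTheorem9_general {C : Type u} [Category.{v} C] [Regular C] {X Y Z : C}
    {R S : EquivRel X} {f : X ⟶ Y} {g : X ⟶ Z} [IsRegularEpi f] [IsRegularEpi g]
    (hf : IsKernelPair f R.1.p₀ R.1.p₁) (hg : IsKernelPair g S.1.p₀ S.1.p₁)
    (hinf : R.1 ⊓ S.1 = discreteRel X) (hsup : IsLUB {R, S} (indiscrete X)) :
    (comp R.1 S.1 = comp S.1 R.1 → IsIso (prod.lift f g)) ∧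
      (Maltsev C → IsIso (prod.lift f g)) := by
  have isIso_of_comp_comm (hcomm : comp R.1 S.1 = comp S.1 R.1) : IsIso (prod.lift f g) := by
    have hlub := isLUB_comp (isEquivalenceRelation_comp_iff.2 hcomm)
    have htop : comp S.1 R.1 = ⊤ := congrArg Subtype.val (hlub.unique hsup)
    have := mono_prodLift_of_inf_le_discreteRel hf hg hinf.le
    have := strongEpi_prodLift_of_comp_eq_top hf hg htop
    exact isIso_of_mono_of_strongEpi _
  exact ⟨isIso_of_comp_comm, fun _ => isIso_of_comp_comm (Maltsev.comp_comm R S)⟩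

theorem mainTheorem9 {C : Type u} [Category.{v} C] [DirectProduct.BarrExact C] :
    (∀ (X : C) (R S : DirectProduct.EquivRel X),
      R.1 ⊓ S.1 = DirectProduct.discreteRel X →
      DirectProduct.comp R.1 S.1 = DirectProduct.comp S.1 R.1 →
      IsLUB {R, S} (DirectProduct.indiscrete X) →
      ∃ e : X ≅ DirectProduct.quotient R ⨯ DirectProduct.quotient S,
        e.hom = prod.lift (DirectProduct.quotientMap R) (DirectProduct.quotientMap S)) ∧
    (DirectProduct.Maltsev C → ∀ (X : C) (R S : DirectProduct.EquivRel X),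
      R.1 ⊓ S.1 = DirectProduct.discreteRel X →
      IsLUB {R, S} (DirectProduct.indiscrete X) →
      ∃ e : X ≅ DirectProduct.quotient R ⨯ DirectProduct.quotient S,
        e.hom = prod.lift (DirectProduct.quotientMap R) (DirectProduct.quotientMap S)) := by
  have isIso_prodLift {X : C} (R S : DirectProduct.EquivRel X) := mainTheorem9_general
    (DirectProduct.isKernelPair_quotientMap R) (DirectProduct.isKernelPair_quotientMap S)
  refine ⟨fun X R S hinf hcomm hsup => ?_, fun hM X R S hinf hsup => ?_⟩
  · have := (isIso_prodLift R S hinf hsup).1 hcomm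
    exact ⟨asIso (prod.lift _ _), rfl⟩
  · have := (isIso_prodLift R S hinf hsup).2 hM
    exact ⟨asIso (prod.lift _ _), rfl⟩
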